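/- \textbf{Conventions.} A monoid is a commutative cancellative semigroup with identity. Let $H$ be a monoid, written multiplicatively, with unit group $H^{\times}$, set of atoms $\mathcal A(H)$ and reduced monoid $H_{\mathrm{red}}=H/H^{\times}$; put $\mathbb N=\{1,2,\dots\}$, $\mathbb N_0=\mathbb N\cup\{0\}$. $H$ is \emph{strongly primary} if $H\neq H^{\times}$ and for each $a\in H\setminus H^{\times}$ there is $n\in\mathbb N$ with $(H\setminus H^{\times})^n\subset aH$; the smallest such $n$ is denoted by $\mathcal M(a)$. A factorization of $a\in H$ is an element $z$ of the free commutative monoid on $\mathcal A(H_{\mathrm{red}})$ with product $aH^{\times}$; $\mathsf Z(a)$ is the set of factorizations of $a$, $|z|$ is the number of atoms in $z$ (with multiplicity), and $\mathsf L(a)=\{|z|:z\in\mathsf Z(a)\}$. The distance $\mathsf d(z,z')$ is $\max\{m,n\}$, where $m,n$ are the lengths of what remains of $z,z'$ after cancelling their greatest common part. For an atom $u$ of $H_{\mathrm{red}}$, $\mathsf t(H,u)$ is the smallest $N\in\mathbb N_0\cup\{\infty\}$ such that for every $a\in H$ having a factorization that contains $u$, and every $z\in\mathsf Z(a)$, there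 is $z'\in\mathsf Z(a)$ containing $u$ with $\mathsf d(z,z')\le N$. $H$ is \emph{locally tame} if $\mathsf t(H,u)<\infty$ for every atom $u$ of $H_{\mathrm{red}}$. Put $\Lambda(H)=\sup\{\min\mathsf L(a):a\in H\}$. The catenary degree $\mathsf c(H)$ is the smallest $N\in\mathbb N_0\cup\{\infty\}$ such that for every $a\in H$ any two factorizations $z,z'$ of $a$ are joined by a finite sequence $z=z_0,\dots,z_k=z'$ in $\mathsf Z(a)$ with $\mathsf d(z_{i-1},z_i)\le N$ for all $i$. The set of distances $\Delta(H)$ consists of all differences $l'-l$ of consecutive elements $l<l'$ of some $\mathsf L(a)$, $a\in H$. If $H \ne H^{\times}$ and $k\in\mathbb N$, then $\mathcal U_k(H)$ is the union of all sets $\mathsf L(a)$ with $k\in\mathsf L(a)$, $\lambda_k(H)=\min\mathcal U_k(H)$ and $\rho_k(H)=\sup\mathcal U_k(H)\in\mathbb N\cup\{\infty\}$. For $x\in\mathbb Z$ and $y\in\mathbb Z\cup\{\infty\}$, $[\![x,y]\!]$ is the set of integers $j$ with $x\le j\le y$ (with $\infty-m=\infty$). \textbf{Theorem.} Let $H$ be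 a locally tame strongly primary monoid. \begin{enumerate} \item We have \[\mathsf c(H)\le\min\Bigl(\{1+\Lambda(H)\}\cup\bigl\{\max\{\mathcal M(u)-1,\ \mathsf t(H,uH^{\times})\}: u\in\mathcal A(H)\bigr\}\Bigr),\] and the set of distances $\Delta(H)$ is finite. \item Suppose that $\Delta(H)\neq\emptyset$ and set $d=\min\Delta(H)$. \begin{enumerate} \item There is $M\in\mathbb N_0$ such that for every $a\in H$ the set $\mathsf L(a)$ is finite and non-empty, and \[\bigl(\min\mathsf L(a)+d\,\mathbb N_0\bigr)\cap[\![\min\mathsf L(a)+M,\ \max\mathsf L(a)-M]\!]\subset\mathsf L(a)\subset\min\mathsf L(a)+d\,\mathbb N_0 .\] \item There is $M'\in\mathbb N_0$ such that for every $k\in\mathbb N$ the set $\mathcal U_k(H)$ is non-empty, and \[\bigl(\lambda_k(H)+d\,\mathbb N_0\bigr)\cap[\![\lambda_k(H)+M',\ \rho_k(H)-M']\!]\subset\mathcal U_k(H)\subset\lambda_k(H)+d\,\mathbb N_0 .\] \end{enumerate} \end{enumerate} -/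

import Mathlib

open scoped Pointwise

noncomputable section

/-! Arithmetic of commutative cancellative monoids, written multiplicatively.
`Associates H` is the reduced monoid `H_red = H / Hˣ`, `Irreducible` means atom,
and `nonunits H` is `H ∖ Hˣ`. -/

namespace FactMonoid

/-- `H` is not a group, and for each non-invertible `a` there is a positive integer `n` with
`(H ∖ Hˣ) ^ n ⊆ aH`. -/
def IsStronglyPrimary (H : Type*) [CancelCommMonoid H] : Prop :=
  (nonunits H).Nonempty ∧
    ∀ a ∈ nonunits H, ∃ n : ℕ, 1 ≤ n ∧ (nonunits H) ^ n ⊆ {x : H | a ∣ x}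

/-- `𝓜(a)`: the smallest positive integer `n` with `(H ∖ Hˣ) ^ n ⊆ aH` (`⊤` if there is none). -/
def primaryExponent {H : Type*} [CancelCommMonoid H] (a : H) : ℕ∞ :=
  ⨅ (n : ℕ) (_ : 1 ≤ n ∧ (nonunits H) ^ n ⊆ {x : H | a ∣ x}), (n : ℕ∞)

/-- `𝖹(a)`: the factorizations of `a`, that is, the elements of the free commutative monoid on the
atoms of `H_red` (multisets of atoms of `H_red`) whose product is `aHˣ`. -/
def factorizations {H : Type*} [CancelCommMonoid H] (a : H) : Set (Multiset (Associates H)) :=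
  {z | (∀ u ∈ z, Irreducible u) ∧ z.prod = Associates.mk a}

/-- `𝖫(a)`: the set of lengths of `a`. -/
def lengths {H : Type*} [CancelCommMonoid H] (a : H) : Set ℕ :=
  {l | ∃ z ∈ factorizations a, Multiset.card z = l}

open Classical in
/-- `𝖽(z, z')`: cancel the greatest common part of `z` and `z'` and take the larger of the two
remaining lengths. -/
def dist {α : Type*} (z z' : Multiset α) : ℕ :=
  max (Multiset.card (z - z')) (Multiset.card (z' - z))

/-- `𝗍(H, u)`: the smallest `N ∈ ℕ ∪ {∞}` such that, whenever some factorization of `a` contains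
`u` and `z` is a factorization of `a`, there is a factorization `z'` of `a` which contains `u` and
has distance at most `N` from `z`. -/
def localTameDegree {H : Type*} [CancelCommMonoid H] (u : Associates H) : ℕ∞ :=
  sInf {N : ℕ∞ | ∀ a : H, (∃ y ∈ factorizations a, u ∈ y) →
    ∀ z ∈ factorizations a, ∃ z' ∈ factorizations a, u ∈ z' ∧ (dist z z' : ℕ∞) ≤ N}

/-- `H` is locally tame: `𝗍(H, u) < ∞` for each atom `u` of `H_red`. -/
def IsLocallyTame (H : Type*) [CancelCommMonoid H] : Prop :=
  ∀ u : Associates H, Irreducible u → localTameDegree u < ⊤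

/-- `Λ(H) = sup {min 𝖫(a) : a ∈ H}`. -/
def Lam (H : Type*) [CancelCommMonoid H] : ℕ∞ :=
  ⨆ a : H, ⨅ l ∈ lengths a, (l : ℕ∞)

/-- `z` and `z'` can be concatenated by an `N`-chain of factorizations of `a`, that is, by
`z = z₀, …, z_k = z'` in `𝖹(a)` with `𝖽(z_{i-1}, z_i) ≤ N` for each `i`. -/
def IsChained {H : Type*} [CancelCommMonoid H] (a : H) (N : ℕ∞)
    (z z' : Multiset (Associates H)) : Prop :=
  Relation.ReflTransGen
    (fun x y => x ∈ factorizations a ∧ y ∈ factorizations a ∧ (dist x y : ℕ∞) ≤ N) z z'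

/-- `𝖼(a)`: the catenary degree of `a`. -/
def elementCatenaryDegree {H : Type*} [CancelCommMonoid H] (a : H) : ℕ∞ :=
  sInf {N : ℕ∞ | ∀ z ∈ factorizations a, ∀ z' ∈ factorizations a, IsChained a N z z'}

/-- `𝖼(H) = sup {𝖼(a) : a ∈ H}`: the catenary degree of `H`. -/
def catenaryDegree (H : Type*) [CancelCommMonoid H] : ℕ∞ :=
  ⨆ a : H, elementCatenaryDegree a

/-- `Δ(L)`: the differences of consecutive elements of `L`. -/
def distances (L : Set ℕ) : Set ℕ :=
  {d | ∃ l ∈ L, ∃ l' ∈ L, l < l' ∧ (∀ x ∈ L, ¬ (l < x ∧ x < l')) ∧ d = l' - l}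

/-- `Δ(H)`: the union of the sets `Δ(𝖫(a))`, `a ∈ H`. -/
def distanceSet (H : Type*) [CancelCommMonoid H] : Set ℕ :=
  ⋃ a : H, distances (lengths a)

open Classical in
/-- `𝓤_k(H)`: the union of all sets of lengths containing `k` (and `{k}` if `H` is a group). -/
def unionLengths (H : Type*) [CancelCommMonoid H] (k : ℕ) : Set ℕ :=
  if ∀ a : H, IsUnit a then {k} else {l | ∃ a : H, k ∈ lengths a ∧ l ∈ lengths a}

/-- `ρ_k(H) = sup 𝓤_k(H) ∈ ℕ ∪ {∞}`. -/
def rhoK (H : Type*) [CancelCommMonoid H] (k : ℕ) : ℕ∞ :=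
  ⨆ l ∈ unionLengths H k, (l : ℕ∞)

/-- `m + d · ℕ₀`. -/
def progression (m d : ℕ) : Set ℕ := {x | ∃ j : ℕ, x = m + d * j}

end FactMonoid

end

namespace FactMonoid

/-! Fix an atom `u`. If `u` divides `a`, tameness moves any two factorizations of `a` to ones
containing `u`, and cancelling `u` shortens the problem; if not, every length of `a` is below
`primaryExponent u`. This gives the tame bound on the catenary degree (`isChained`). The bound `1 +
Lam H` comes from replacing `Lam H + 1` atoms by at most `Lam H`. A finite catenary degree bounds
the gaps in all sets of lengths (`exists_gap_bound`).

Let `d` be the minimal distance. All lengths of an element agree modulo `d`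
(`dvd_sub_of_mem_lengths`), and some `b` has a long progression of difference `d` among its lengths.
Strong primariness makes `b` divide every element with a long factorization, say `a = b * c`;
tameness keeps the lengths of `c` close to those of `a`, and the progression of `b` fills the
bounded gaps of `c`. Only the ends of the set of lengths escape. For unions, a number far from `k`
is interior to a single set of lengths, and one near `k` is reached by padding `b` with atoms. -/

variable {H : Type*} [CancelCommMonoid H]

/-! ### Passing between `H` and its reduced monoid; sums of factorizations -/

theorem irreducible_mk {a : H} : Irreducible (Associates.mk a) ↔ Irreducible a := by
  simp only [irreducible_iff, Associates.isUnit_mk, Associates.forall_associated,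
    Associates.mk_mul_mk, Associates.mk_eq_mk_iff_associated, Associated.comm (x := a)]
  refine Iff.rfl.and ⟨fun h x y hxy => h _ _ (hxy ▸ .refl _), ?_⟩
  rintro h x y ⟨u, rfl⟩
  simpa using h (mul_assoc x y u)

theorem exists_eq_mul_of_mk_eq_mul {a : H} {x y : Associates H} (h : x * y = Associates.mk a) :
    ∃ b c : H, Associates.mk b = x ∧ Associates.mk c = y ∧ a = b * c := by
  obtain ⟨b, rfl⟩ := Associates.mk_surjective x
  obtain ⟨c, rfl⟩ := Associates.mk_surjective y
  rw [Associates.mk_mul_mk, Associates.mk_eq_mk_iff_associated] at h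
  obtain ⟨e, he⟩ := h
  refine ⟨b, c * e, rfl, ?_, by rw [← he, mul_assoc]⟩
  rw [Associates.mk_eq_mk_iff_associated]
  exact (associated_mul_unit_left c e e.isUnit)

theorem mk_mul_left_cancel {a : H} {x y : Associates H}
    (h : Associates.mk a * x = Associates.mk a * y) :
    x = y := by
  obtain ⟨b, rfl⟩ := Associates.mk_surjective x
  obtain ⟨c, rfl⟩ := Associates.mk_surjective y
  rw [Associates.mk_mul_mk, Associates.mk_mul_mk, Associates.mk_eq_mk_iff_associated] at h
  obtain ⟨e, he⟩ := h
  rw [Associates.mk_eq_mk_iff_associated]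
  exact ⟨e, mul_left_cancel (a := a) (by rw [← mul_assoc, he])⟩

theorem add_mem_factorizations {a b : H} {z w : Multiset (Associates H)}
    (hz : z ∈ factorizations a) (hw : w ∈ factorizations b) : z + w ∈ factorizations (a * b) := by
  refine ⟨fun u hu => ?_, by rw [Multiset.prod_add, hz.2, hw.2, Associates.mk_mul_mk]⟩
  rcases Multiset.mem_add.1 hu with h | h
  exacts [hz.1 u h, hw.1 u h]

theorem singleton_mem_factorizations {u : H} (hu : Irreducible u) :
    ({Associates.mk u} : Multiset (Associates H)) ∈ factorizations u :=
  ⟨fun x hx => by rw [Multiset.mem_singleton.1 hx]; exact irreducible_mk.2 hu, by simp⟩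

theorem zero_mem_factorizations : (0 : Multiset (Associates H)) ∈ factorizations (1 : H) :=
  ⟨by simp, by simp⟩

theorem exists_eq_mul_of_add_mem_factorizations {a : H} {z w : Multiset (Associates H)}
    (h : z + w ∈ factorizations a) :
    ∃ b c : H, z ∈ factorizations b ∧ w ∈ factorizations c ∧ a = b * c := by
  obtain ⟨b, c, hb, hc, rfl⟩ := exists_eq_mul_of_mk_eq_mul (a := a) (Multiset.prod_add z w ▸ h.2)
  exact ⟨b, c, ⟨fun u hu => h.1 u (Multiset.mem_add.2 (.inl hu)), hb.symm⟩,
    ⟨fun u hu => h.1 u (Multiset.mem_add.2 (.inr hu)), hc.symm⟩, rfl⟩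

theorem mem_factorizations_of_cons {u c : H} {w : Multiset (Associates H)}
    (h : {Associates.mk u} + w ∈ factorizations (u * c)) : w ∈ factorizations c := by
  refine ⟨fun x hx => h.1 x (Multiset.mem_add.2 (.inr hx)), mk_mul_left_cancel (a := u) ?_⟩
  rw [Associates.mk_mul_mk, ← h.2, Multiset.prod_add, Multiset.prod_singleton]

theorem exists_eq_singleton_add {α : Type*} {u : α} {z : Multiset α} (h : u ∈ z) :
    ∃ w, z = {u} + w := by
  obtain ⟨w, rfl⟩ := Multiset.exists_cons_of_mem h
  exact ⟨w, (Multiset.singleton_add u w).symm⟩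

theorem add_mem_lengths {a b : H} {k l : ℕ} (hk : k ∈ lengths a) (hl : l ∈ lengths b) :
    k + l ∈ lengths (a * b) := by
  obtain ⟨z, hz, rfl⟩ := hk
  obtain ⟨w, hw, rfl⟩ := hl
  exact ⟨z + w, add_mem_factorizations hz hw, Multiset.card_add z w⟩

theorem zero_mem_lengths_one : 0 ∈ lengths (1 : H) := ⟨0, zero_mem_factorizations, rfl⟩

theorem one_mem_lengths {u : H} (hu : Irreducible u) : 1 ∈ lengths u :=
  ⟨_, singleton_mem_factorizations hu, rfl⟩

theorem mul_mem_lengths_pow {a : H} {l : ℕ} (h : l ∈ lengths a) (n : ℕ) :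
    n * l ∈ lengths (a ^ n) := by
  induction n with
  | zero => simpa using zero_mem_lengths_one
  | succ n ih => rw [pow_succ, add_mul, one_mul]; exact add_mem_lengths ih h

/-! ### The distance of factorizations -/

theorem dist_le_max {α : Type*} (z z' : Multiset α) :
    dist z z' ≤ max (Multiset.card z) (Multiset.card z') := by
  classical
  unfold dist
  exact max_le_max (Multiset.card_le_card (by convert Multiset.sub_le_self z z'))
    (Multiset.card_le_card (by convert Multiset.sub_le_self z' z))

theorem dist_comm {α : Type*} (z z' : Multiset α) : dist z z' = dist z' z := by
  unfold dist
  exact max_comm _ _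

theorem dist_add_left {α : Type*} (w z z' : Multiset α) : dist (w + z) (w + z') = dist z z' := by
  classical
  unfold dist
  rw [add_tsub_add_eq_tsub_left, add_tsub_add_eq_tsub_left]

theorem card_le_card_add_dist {α : Type*} (z z' : Multiset α) :
    Multiset.card z' ≤ Multiset.card z + dist z z' := by
  classical
  have h : Multiset.card z' ≤ Multiset.card (z' - z + z) := Multiset.card_le_card le_tsub_add
  rw [Multiset.card_add, add_comm] at h
  refine h.trans (Nat.add_le_add_left ?_ _)
  unfold dist
  convert le_max_right _ _

/-! ### Chains of factorizations -/

theorem IsChained.symm {a : H} {N : ℕ∞} {z z' : Multiset (Associates H)} (h : IsChained a N z z') :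
    IsChained a N z' z :=
  haveI : Std.Symm (fun x y => x ∈ factorizations a ∧ y ∈ factorizations a ∧
      (dist x y : ℕ∞) ≤ N) :=
    ⟨fun x y hxy => ⟨hxy.2.1, hxy.1, by rw [dist_comm]; exact hxy.2.2⟩⟩
  Relation.ReflTransGen.stdSymm.symm _ _ h

theorem IsChained.of_dist_le {a : H} {N : ℕ∞} {z z' : Multiset (Associates H)}
    (hz : z ∈ factorizations a) (hz' : z' ∈ factorizations a) (h : (dist z z' : ℕ∞) ≤ N) :
    IsChained a N z z' :=
  Relation.ReflTransGen.single ⟨hz, hz', h⟩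

theorem IsChained.add_left {a b : H} {N : ℕ∞} {w z z' : Multiset (Associates H)}
    (hw : w ∈ factorizations b) (h : IsChained a N z z') : IsChained (b * a) N (w + z) (w + z') :=
  Relation.ReflTransGen.lift (w + ·) (fun x y hxy => ⟨add_mem_factorizations hw hxy.1,
    add_mem_factorizations hw hxy.2.1, by rw [dist_add_left]; exact hxy.2.2⟩) _ _ h

theorem catenaryDegree_le {N : ℕ∞}
    (h : ∀ a : H, ∀ z ∈ factorizations a, ∀ z' ∈ factorizations a, IsChained a N z z') :
    catenaryDegree H ≤ N :=
  iSup_le fun a => sInf_le (h a)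

/-- Along an `N`-chain lengths change by at most `N`, so they leave no large gaps. -/
theorem IsChained.exists_length {a : H} {N x : ℕ} {z z' : Multiset (Associates H)}
    (h : IsChained a N z z') (hz : z ∈ factorizations a) (hx : Multiset.card z ≤ x)
    (hx' : x ≤ Multiset.card z') : ∃ y ∈ lengths a, y ≤ x ∧ x ≤ y + N := by
  by_contra! hcon
  -- By `hcon` every length at most `x` lies below `x - N`, and a step of size `N` cannot jump this
  -- window.
  have key : Multiset.card z' + N < x := by
    induction h with
    | refl => exact hcon _ ⟨z, hz, rfl⟩ hx
    | @tail b c _ hbc ih =>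
      by_cases hb : x ≤ Multiset.card b
      · have := ih hb
        omega
      · have h1 := hcon _ ⟨b, hbc.1, rfl⟩ (by omega)
        have h2 : dist b c ≤ N := by exact_mod_cast hbc.2.2
        have h3 := card_le_card_add_dist b c
        exact hcon _ ⟨c, hbc.2.1, rfl⟩ (by omega)
  omega

/-! ### Strongly primary monoids -/

theorem not_isUnit_of_mk_irreducible {y : H} (h : Irreducible (Associates.mk y)) : ¬ IsUnit y :=
  (irreducible_mk.1 h).not_isUnit

theorem exists_mem_pow_mul {n : ℕ} {a : H} {z : Multiset (Associates H)}
    (hz : z ∈ factorizations a) (hn : n ≤ Multiset.card z) :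
    ∃ b ∈ (nonunits H) ^ n, ∃ c, a = b * c := by
  induction n generalizing a z with
  | zero => exact ⟨1, by simp, a, by simp⟩
  | succ n ih =>
    obtain ⟨y, hy⟩ := Multiset.card_pos_iff_exists_mem.1 (show 0 < Multiset.card z by omega)
    obtain ⟨w, rfl⟩ := exists_eq_singleton_add hy
    obtain ⟨p, q, hp, hq, rfl⟩ := exists_eq_mul_of_add_mem_factorizations hz
    obtain ⟨b, hb, c, rfl⟩ := ih hq (by simp at hn; omega)
    refine ⟨b * p, ?_, c, by rw [mul_left_comm, mul_assoc, mul_left_comm]⟩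
    rw [pow_succ]
    refine Set.mul_mem_mul hb ?_
    have h1 := hp.2
    rw [Multiset.prod_singleton] at h1
    exact not_isUnit_of_mk_irreducible (h1 ▸ hp.1 y (Multiset.mem_singleton_self y))

theorem dvd_of_le_card {n : ℕ} {u a : H} (hu : (nonunits H) ^ n ⊆ {x : H | u ∣ x})
    {z : Multiset (Associates H)} (hz : z ∈ factorizations a) (hn : n ≤ Multiset.card z) : u ∣ a := by
  obtain ⟨b, hb, c, rfl⟩ := exists_mem_pow_mul hz hn
  exact Dvd.dvd.mul_right (hu hb) c

theorem not_dvd_right {y c : H} (hy : ¬ IsUnit y) : ¬ y * c ∣ c := by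
  rintro ⟨e, he⟩
  refine hy (IsUnit.of_mul_eq_one e (mul_left_cancel (a := c) ?_))
  rw [mul_one, mul_left_comm, ← mul_assoc, ← he]

/-- With more than `n` atoms, dropping one would leave a proper divisor of `a` that is still a
multiple of `a`. -/
theorem card_le_of_pow_subset {n : ℕ} {a : H} (ha : (nonunits H) ^ n ⊆ {x : H | a ∣ x})
    {z : Multiset (Associates H)} (hz : z ∈ factorizations a) : Multiset.card z ≤ n := by
  by_contra! hn
  obtain ⟨y, hy⟩ := Multiset.card_pos_iff_exists_mem.1 (show 0 < Multiset.card z by omega)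
  obtain ⟨w, rfl⟩ := exists_eq_singleton_add hy
  obtain ⟨p, q, hp, hq, rfl⟩ := exists_eq_mul_of_add_mem_factorizations hz
  have h1 := hp.2
  rw [Multiset.prod_singleton] at h1
  exact not_dvd_right
    (not_isUnit_of_mk_irreducible (h1 ▸ hp.1 y (Multiset.mem_singleton_self y)))
    (dvd_of_le_card ha hq (by simp at hn; omega))

theorem eq_zero_of_mem_factorizations_of_isUnit {a : H} (ha : IsUnit a)
    {z : Multiset (Associates H)} (hz : z ∈ factorizations a) : z = 0 := by
  by_contra h0
  obtain ⟨y, hy⟩ := Multiset.exists_mem_of_ne_zero h0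
  have h1 : y ∣ 1 := by
    rw [← Associates.mk_eq_one.2 ha, ← hz.2]
    exact Multiset.dvd_prod hy
  exact (hz.1 y hy).not_isUnit (isUnit_of_dvd_one h1)

theorem zero_mem_factorizations_of_isUnit {a : H} (ha : IsUnit a) :
    (0 : Multiset (Associates H)) ∈ factorizations a :=
  ⟨by simp, by simpa using (Associates.mk_eq_one.2 ha).symm⟩

theorem IsStronglyPrimary.exists_card_le (hsp : IsStronglyPrimary H) (a : H) :
    ∃ n, ∀ z ∈ factorizations a, Multiset.card z ≤ n := by
  by_cases ha : IsUnit a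
  · exact ⟨0, fun z hz => by simp [eq_zero_of_mem_factorizations_of_isUnit ha hz]⟩
  · obtain ⟨n, -, h⟩ := hsp.2 a ha
    exact ⟨n, fun z hz => card_le_of_pow_subset h hz⟩

theorem not_dvd_of_pow_subset {n : ℕ} {a b : H} (hb : b ∈ (nonunits H) ^ n)
    (ha : (nonunits H) ^ n ⊆ {x : H | a ∣ x}) {c : H} (hc : ¬ IsUnit c) : a ≠ b * c := by
  rintro rfl
  refine not_dvd_right (y := c) (c := b) hc ?_
  rw [mul_comm]
  exact ha hb

/-- Atomicity: `k` counts the nonunit factors that can still be split off. When `c = p * q` is not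
an atom, each factor is treated with the other moved into `b`, which lowers `k`; at `k = 0` a
nonunit `c` is impossible. -/
theorem exists_factorization_of_pow_subset {a : H} (k : ℕ) {n : ℕ} {b c : H}
    (ha : (nonunits H) ^ n ⊆ {x : H | a ∣ x}) (hb : b ∈ (nonunits H) ^ (n - k)) (hk : k ≤ n)
    (hbc : b * c ∣ a) :
    (factorizations c).Nonempty := by
  by_cases hc : IsUnit c
  · exact ⟨0, zero_mem_factorizations_of_isUnit hc⟩
  induction k generalizing b c with
  | zero =>
    obtain ⟨e, he⟩ := hbc
    rw [mul_assoc] at he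
    exact absurd he (not_dvd_of_pow_subset (by simpa using hb) ha
      (fun h => hc (isUnit_of_mul_isUnit_left h)))
  | succ k ih =>
    by_cases hirr : Irreducible c
    · exact ⟨_, singleton_mem_factorizations hirr⟩
    · have : ∃ p q, c = p * q ∧ ¬ IsUnit p ∧ ¬ IsUnit q := by
        by_contra! h
        exact hirr ⟨hc, fun p q hpq => or_iff_not_imp_left.2 (h p q hpq)⟩
      obtain ⟨p, q, rfl, hp, hq⟩ := this
      have hnk : n - k = n - (k + 1) + 1 := by omega
      obtain ⟨z, hz⟩ := ih (b := b * q) (c := p) (by rw [hnk, pow_succ]; exact Set.mul_mem_mul hb hq)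
        (by omega) (by rwa [mul_assoc, mul_comm q p]) hp
      obtain ⟨w, hw⟩ := ih (b := b * p) (c := q) (by rw [hnk, pow_succ]; exact Set.mul_mem_mul hb hp)
        (by omega) (by rwa [mul_assoc]) hq
      exact ⟨z + w, add_mem_factorizations hz hw⟩

theorem IsStronglyPrimary.factorizations_nonempty (hsp : IsStronglyPrimary H) (a : H) :
    (factorizations a).Nonempty := by
  by_cases ha : IsUnit a
  · exact ⟨0, zero_mem_factorizations_of_isUnit ha⟩
  · obtain ⟨n, -, h⟩ := hsp.2 a ha
    exact exists_factorization_of_pow_subset n (b := 1) h (by simp) le_rfl (by simp)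

theorem IsStronglyPrimary.lengths_nonempty (hsp : IsStronglyPrimary H) (a : H) :
    (lengths a).Nonempty := by
  obtain ⟨z, hz⟩ := hsp.factorizations_nonempty a
  exact ⟨_, z, hz, rfl⟩

theorem IsStronglyPrimary.exists_isLeast_isGreatest (hsp : IsStronglyPrimary H) (a : H) :
    ∃ m n, IsLeast (lengths a) m ∧ IsGreatest (lengths a) n := by
  obtain ⟨B, hB⟩ := hsp.exists_card_le a
  have hb : BddAbove (lengths a) := ⟨B, by rintro _ ⟨z, hz, rfl⟩; exact hB z hz⟩
  have hne := hsp.lengths_nonempty a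
  exact ⟨_, _, ⟨Nat.sInf_mem hne, fun x hx => Nat.sInf_le hx⟩,
    ⟨Nat.sSup_mem hne hb, fun x hx => le_csSup hb hx⟩⟩

theorem IsStronglyPrimary.exists_irreducible (hsp : IsStronglyPrimary H) :
    ∃ u : H, Irreducible u := by
  obtain ⟨a, ha⟩ := hsp.1
  obtain ⟨z, hz⟩ := hsp.factorizations_nonempty a
  have h0 : z ≠ 0 := by
    rintro rfl
    exact ha (Associates.mk_eq_one.1 (by simpa using hz.2.symm))
  obtain ⟨y, hy⟩ := Multiset.exists_mem_of_ne_zero h0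
  obtain ⟨u, rfl⟩ := Associates.mk_surjective y
  exact ⟨u, irreducible_mk.1 (hz.1 _ hy)⟩

theorem IsStronglyPrimary.exists_primaryExponent_eq (hsp : IsStronglyPrimary H) {u : H}
    (hu : ¬ IsUnit u) :
    ∃ n : ℕ, 1 ≤ n ∧ (nonunits H) ^ n ⊆ {x : H | u ∣ x} ∧ primaryExponent u = n := by
  have hne : {n : ℕ | 1 ≤ n ∧ (nonunits H) ^ n ⊆ {x : H | u ∣ x}}.Nonempty := hsp.2 u hu
  have hmem := Nat.sInf_mem hne
  refine ⟨_, hmem.1, hmem.2, le_antisymm (iInf₂_le _ hmem) (le_iInf₂ fun n hn => ?_)⟩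
  exact_mod_cast Nat.sInf_le hn

/-! ### Tameness and the catenary degree -/

theorem exists_dist_le_localTameDegree (u : Associates H) (a : H)
    (h : ∃ y ∈ factorizations a, u ∈ y) {z : Multiset (Associates H)} (hz : z ∈ factorizations a) :
    ∃ z' ∈ factorizations a, u ∈ z' ∧ (dist z z' : ℕ∞) ≤ localTameDegree u := by
  have hmem : localTameDegree u ∈ {N : ℕ∞ | ∀ a : H, (∃ y ∈ factorizations a, u ∈ y) →
      ∀ z ∈ factorizations a, ∃ z' ∈ factorizations a, u ∈ z' ∧ (dist z z' : ℕ∞) ≤ N} :=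
    -- The infimum is attained because `⊤` is always admissible.
    csInf_mem ⟨⊤, fun a ⟨y, hy, huy⟩ z _ => ⟨y, hy, huy, le_top⟩⟩
  exact hmem a h z hz

theorem IsStronglyPrimary.exists_dist_le (hsp : IsStronglyPrimary H) {u c : H}
    (hu : Irreducible u) {z : Multiset (Associates H)} (hz : z ∈ factorizations (u * c)) :
    ∃ w ∈ factorizations c, {Associates.mk u} + w ∈ factorizations (u * c) ∧
      (dist z ({Associates.mk u} + w) : ℕ∞) ≤ localTameDegree (Associates.mk u) := by
  obtain ⟨w₀, hw₀⟩ := hsp.factorizations_nonempty c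
  obtain ⟨z', hz', huz', hd⟩ := exists_dist_le_localTameDegree (Associates.mk u) (u * c)
    ⟨_, add_mem_factorizations (singleton_mem_factorizations hu) hw₀, by simp⟩ hz
  obtain ⟨w, rfl⟩ := exists_eq_singleton_add huz'
  exact ⟨w, mem_factorizations_of_cons hz', hz', hd⟩

theorem IsStronglyPrimary.isChained (hsp : IsStronglyPrimary H) {u : H} (hu : Irreducible u)
    (a : H) {z z' : Multiset (Associates H)} (hz : z ∈ factorizations a)
    (hz' : z' ∈ factorizations a) :
    IsChained a (max (primaryExponent u - 1) (localTameDegree (Associates.mk u))) z z' := by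
  obtain ⟨n, hn1, hn, hpe⟩ := hsp.exists_primaryExponent_eq hu.not_isUnit
  rw [hpe]
  obtain ⟨B, hB⟩ := hsp.exists_card_le a
  -- Induction on a bound for the lengths of `a`, which drops when `u` is split off.
  induction B generalizing a z z' with
  | zero =>
    have h1 : z = 0 := by simpa using hB z hz
    have h2 : z' = 0 := by simpa using hB z' hz'
    rw [h1, h2]
    exact Relation.ReflTransGen.refl
  | succ B ih =>
    by_cases hdvd : u ∣ a
    · obtain ⟨c, rfl⟩ := hdvd
      obtain ⟨w, hw, hzw, hd⟩ := hsp.exists_dist_le hu hz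
      obtain ⟨w', hw', hzw', hd'⟩ := hsp.exists_dist_le hu hz'
      have hmid := ih c hw hw' fun x hx => by
        have := hB _ (add_mem_factorizations (singleton_mem_factorizations hu) hx)
        simp at this
        omega
      exact ((IsChained.of_dist_le hz hzw (hd.trans (le_max_right _ _))).trans
        (hmid.add_left (singleton_mem_factorizations hu))).trans
        (IsChained.of_dist_le hz' hzw' (hd'.trans (le_max_right _ _))).symm
    · have hlt : ∀ x ∈ factorizations a, Multiset.card x ≤ n - 1 := fun x hx => by
        by_contra! h
        exact hdvd (dvd_of_le_card hn hx (by omega))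
      refine IsChained.of_dist_le hz hz' (le_max_of_le_left ?_)
      have := (dist_le_max z z').trans (max_le (hlt z hz) (hlt z' hz'))
      exact_mod_cast this

theorem exists_card_le_of_Lam_eq {L : ℕ} (hL : Lam H = L) (a : H) :
    ∃ z ∈ factorizations a, Multiset.card z ≤ L := by
  by_contra! h
  have h1 : ((L + 1 : ℕ) : ℕ∞) ≤ ⨅ l ∈ lengths a, (l : ℕ∞) := by
    refine le_iInf₂ fun l hl => ?_
    obtain ⟨z, hz, rfl⟩ := hl
    exact_mod_cast h z hz
  have h2 := h1.trans ((le_iSup (fun a : H => ⨅ l ∈ lengths a, (l : ℕ∞)) a).trans hL.le)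
  have h3 : L + 1 ≤ L := by exact_mod_cast h2
  omega

/-- While more than `L` atoms remain, refactoring `L + 1` of them into at most `L` is a step of size
at most `1 + L` that shortens the factorization. -/
theorem exists_isChained_card_le {L : ℕ} (hL : Lam H = L) (a : H) {z : Multiset (Associates H)}
    (hz : z ∈ factorizations a) :
    ∃ z' ∈ factorizations a, Multiset.card z' ≤ L ∧ IsChained a (1 + L) z z' := by
  induction hn : Multiset.card z using Nat.strong_induction_on generalizing z with
  | _ n ih =>
  by_cases hle : Multiset.card z ≤ L
  · exact ⟨z, hz, hle, Relation.ReflTransGen.refl⟩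
  obtain ⟨x, hx⟩ := Multiset.card_pos_iff_exists_mem.1
    (show 0 < Multiset.card (Multiset.powersetCard (L + 1) z) by
      rw [Multiset.card_powersetCard]
      exact Nat.choose_pos (by omega))
  obtain ⟨hxz, hx⟩ := Multiset.mem_powersetCard.1 hx
  obtain ⟨y, rfl⟩ := Multiset.le_iff_exists_add.1 hxz
  obtain ⟨b, c, hb, hc, rfl⟩ := exists_eq_mul_of_add_mem_factorizations hz
  obtain ⟨x', hx', hx'L⟩ := exists_card_le_of_Lam_eq hL b
  have hmem := add_mem_factorizations hx' hc
  obtain ⟨z', hz', hz'L, hch⟩ := ih (Multiset.card (x' + y)) (by simp at hn ⊢; omega) hmem rfl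
  refine ⟨z', hz', hz'L, (IsChained.of_dist_le hz hmem ?_).trans hch⟩
  rw [add_comm x y, add_comm x' y, dist_add_left]
  have : dist x x' ≤ 1 + L := (dist_le_max x x').trans (by omega)
  exact_mod_cast this

theorem catenaryDegree_le_one_add_Lam : catenaryDegree H ≤ 1 + Lam H := by
  rcases eq_or_ne (Lam H) ⊤ with h | h
  · rw [h, add_top]
    exact le_top
  obtain ⟨L, hL⟩ := ENat.ne_top_iff_exists.1 h
  rw [← hL]
  refine catenaryDegree_le fun a z hz z' hz' => ?_
  obtain ⟨w, hw, hwL, hzw⟩ := exists_isChained_card_le hL.symm a hz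
  obtain ⟨w', hw', hwL', hzw'⟩ := exists_isChained_card_le hL.symm a hz'
  refine (hzw.trans (IsChained.of_dist_le hw hw' ?_)).trans hzw'.symm
  have : dist w w' ≤ 1 + L := (dist_le_max w w').trans (by omega)
  exact_mod_cast this

/-- A locally tame strongly primary monoid has finite catenary degree, so its sets of lengths have
bounded gaps. -/
theorem IsStronglyPrimary.exists_gap_bound (hsp : IsStronglyPrimary H) (hlt : IsLocallyTame H) :
    ∃ N : ℕ, ∀ (a : H) (m n x : ℕ), m ∈ lengths a → n ∈ lengths a → m ≤ x → x ≤ n →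
      ∃ y ∈ lengths a, y ≤ x ∧ x ≤ y + N := by
  obtain ⟨u, hu⟩ := hsp.exists_irreducible
  obtain ⟨k, -, -, hk⟩ := hsp.exists_primaryExponent_eq hu.not_isUnit
  obtain ⟨t, ht⟩ := ENat.ne_top_iff_exists.1 (hlt _ (irreducible_mk.2 hu)).ne
  refine ⟨max (k - 1) t, fun a m n x hm hn hmx hxn => ?_⟩
  obtain ⟨z, hz, rfl⟩ := hm
  obtain ⟨z', hz', rfl⟩ := hn
  have h := hsp.isChained hu a hz hz'
  rw [hk, ← ht] at h
  exact IsChained.exists_length (by exact_mod_cast h) hz hmx hxn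

theorem IsStronglyPrimary.distanceSet_finite (hsp : IsStronglyPrimary H) (hlt : IsLocallyTame H) :
    (distanceSet H).Finite := by
  obtain ⟨N, hN⟩ := hsp.exists_gap_bound hlt
  refine (Set.finite_Iic (N + 1)).subset ?_
  intro d hd
  obtain ⟨a, l, hl, l', hl', hll', hgap, rfl⟩ := Set.mem_iUnion.1 hd
  -- A length `y ≤ l' - 1` must satisfy `y ≤ l`, so the gap is at most `N + 1`.
  obtain ⟨y, hy, hy1, hy2⟩ := hN a l l' (l' - 1) hl hl' (by omega) (by omega)
  have := hgap y hy
  simp only [Set.mem_Iic]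
  omega

/-! ### Sets of lengths -/

theorem exists_distances_le {L : Set ℕ} {l l' : ℕ} (hl : l ∈ L) (hl' : l' ∈ L) (h : l < l') :
    ∃ e ∈ distances L, e ≤ l' - l := by
  have hne : {x | x ∈ L ∧ l < x}.Nonempty := ⟨l', hl', h⟩
  have hmem := Nat.sInf_mem hne
  have hle : sInf {x | x ∈ L ∧ l < x} ≤ l' := Nat.sInf_le ⟨hl', h⟩
  refine ⟨_, ⟨l, hl, _, hmem.1, hmem.2, fun x hx hx' => ?_, rfl⟩, by omega⟩
  exact absurd (Nat.sInf_le (s := {x | x ∈ L ∧ l < x}) ⟨hx, hx'.1⟩) (by omega)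

theorem exists_lengths_of_mem_distanceSet {d : ℕ} (hd : d ∈ distanceSet H) :
    0 < d ∧ ∃ (a : H) (l : ℕ), l ∈ lengths a ∧ l + d ∈ lengths a := by
  obtain ⟨a, l, hl, l', hl', hll', -, rfl⟩ := Set.mem_iUnion.1 hd
  refine ⟨by omega, a, l, hl, ?_⟩
  rwa [Nat.add_sub_cancel' hll'.le]

/-- Euclidean division: a nonzero remainder `r` would appear as a difference of two lengths of `a ^
q * b`, forcing a distance at most `r < d`. -/
theorem dvd_sub_of_mem_lengths {d : ℕ} (hd : IsLeast (distanceSet H) d) {b : H} {m m' : ℕ}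
    (hm : m ∈ lengths b) (hm' : m' ∈ lengths b) (hle : m ≤ m') : d ∣ m' - m := by
  obtain ⟨hd0, a, l, hl, hld⟩ := exists_lengths_of_mem_distanceSet hd.1
  by_contra hndvd
  have hr0 : 0 < (m' - m) % d := Nat.pos_of_ne_zero fun h => hndvd (Nat.dvd_of_mod_eq_zero h)
  have hrd : (m' - m) % d < d := Nat.mod_lt _ hd0
  have hdiv := Nat.div_add_mod (m' - m) d
  set q := (m' - m) / d
  set r := (m' - m) % d
  have h1 := add_mem_lengths (mul_mem_lengths_pow hld q) hm
  have h2 := add_mem_lengths (mul_mem_lengths_pow hl q) hm'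
  have e : q * (l + d) = q * l + d * q := by ring
  rw [e] at h1
  obtain ⟨f, hf, hfr⟩ := exists_distances_le h1 h2 (by omega)
  have := hd.2 (Set.mem_iUnion.2 ⟨_, hf⟩)
  omega

/-- If `d ∈ Δ(H)`, there are sets of lengths containing arbitrarily long arithmetic progressions
with difference `d`. -/
theorem exists_arithmetic_progression {d : ℕ} (hd : d ∈ distanceSet H) (K : ℕ) :
    ∃ (b : H) (l : ℕ), ∀ j ≤ K, l + d * j ∈ lengths b := by
  obtain ⟨-, a, l, hl, hld⟩ := exists_lengths_of_mem_distanceSet hd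
  refine ⟨a ^ K, K * l, fun j hj => ?_⟩
  have h := add_mem_lengths (mul_mem_lengths_pow hld j) (mul_mem_lengths_pow hl (K - j))
  rw [← pow_add, Nat.add_sub_cancel' hj] at h
  convert h using 1
  obtain ⟨i, rfl⟩ := Nat.exists_eq_add_of_le hj
  rw [Nat.add_sub_cancel_left]
  ring

/-- Splitting off a fixed divisor changes lengths by a bounded amount only. -/
theorem IsStronglyPrimary.exists_tame_bound (hsp : IsStronglyPrimary H) (hlt : IsLocallyTame H)
    (b : H) : ∃ T : ℕ, ∀ (c : H) (l : ℕ), l ∈ lengths (b * c) →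
      ∃ l' ∈ lengths c, l' ≤ l + T ∧ l ≤ l' + T := by
  obtain ⟨z, hz⟩ := hsp.factorizations_nonempty b
  induction z using Multiset.induction_on generalizing b with
  | empty =>
    have hb : IsUnit b := Associates.mk_eq_one.1 (by simpa using hz.2.symm)
    refine ⟨0, fun c l hl => ⟨l, ?_, le_rfl, le_rfl⟩⟩
    obtain ⟨w, hw, rfl⟩ := hl
    refine ⟨w, ⟨hw.1, ?_⟩, rfl⟩
    rw [hw.2, ← Associates.mk_mul_mk, Associates.mk_eq_one.2 hb, one_mul]
  | cons y z ih =>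
    rw [← Multiset.singleton_add] at hz
    obtain ⟨u, b', hu, hb', rfl⟩ := exists_eq_mul_of_add_mem_factorizations hz
    obtain ⟨T, hT⟩ := ih b' hb'
    have hy : Associates.mk u = y := by simpa using hu.2.symm
    have hyirr : Irreducible (Associates.mk u) := hy ▸ hu.1 y (Multiset.mem_singleton_self y)
    obtain ⟨t, ht⟩ := ENat.ne_top_iff_exists.1 (hlt _ hyirr).ne
    -- `t` for reaching a factorization containing `u`, `1` for removing `u`, `T` for the remaining
    -- atoms of `b`.
    refine ⟨t + T + 1, fun c l hl => ?_⟩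
    obtain ⟨x, hx, rfl⟩ := hl
    rw [mul_assoc] at hx
    obtain ⟨w, hw, -, hd⟩ := hsp.exists_dist_le (irreducible_mk.1 hyirr) hx
    rw [← ht] at hd
    have hd' : dist x ({Associates.mk u} + w) ≤ t := by exact_mod_cast hd
    obtain ⟨l', hl', h1, h2⟩ := hT c _ ⟨w, hw, rfl⟩
    have h3 := card_le_card_add_dist x ({Associates.mk u} + w)
    have h4 := card_le_card_add_dist ({Associates.mk u} + w) x
    rw [dist_comm] at h4
    rw [Multiset.card_add, Multiset.card_singleton] at h3 h4
    exact ⟨l', hl', by omega, by omega⟩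

theorem IsStronglyPrimary.exists_pow_dvd (hsp : IsStronglyPrimary H) (b : H) :
    ∃ n : ℕ, ∀ (a : H) (l : ℕ), l ∈ lengths a → n ≤ l → b ∣ a := by
  by_cases hb : IsUnit b
  · exact ⟨0, fun a _ _ _ => hb.dvd⟩
  · obtain ⟨n, -, hn⟩ := hsp.2 b hb
    refine ⟨n, fun a l hl hnl => ?_⟩
    obtain ⟨z, hz, rfl⟩ := hl
    exact dvd_of_le_card hn hz hnl

/-- The structure theorem for sets of lengths. -/
theorem IsStronglyPrimary.exists_lengths_structure (hsp : IsStronglyPrimary H)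
    (hlt : IsLocallyTame H) {d : ℕ} (hd : IsLeast (distanceSet H) d) :
    ∃ M : ℕ, ∀ (a : H) (m n x : ℕ), m ∈ lengths a → n ∈ lengths a → m + M ≤ x → x + M ≤ n →
      d ∣ x - m → x ∈ lengths a := by
  obtain ⟨N, hN⟩ := hsp.exists_gap_bound hlt
  obtain ⟨hd0, -⟩ := exists_lengths_of_mem_distanceSet hd.1
  obtain ⟨b, l, hb⟩ := exists_arithmetic_progression hd.1 N
  obtain ⟨T, hT⟩ := hsp.exists_tame_bound hlt b
  obtain ⟨B, hB⟩ := hsp.exists_pow_dvd b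
  -- `B` forces `b ∣ a`; `T + l` places `x - l` between two lengths of the cofactor `c`.
  refine ⟨T + l + B, fun a m n x hm hn hmx hxn hdvd => ?_⟩
  obtain ⟨c, rfl⟩ := hB a n hn (by omega)
  obtain ⟨m', hm', hm'T, -⟩ := hT c m hm
  obtain ⟨n', hn', -, hn'T⟩ := hT c n hn
  obtain ⟨y, hy, hy1, hy2⟩ := hN c m' n' (x - l) hm' hn' (by omega) (by omega)
  have hl0 : l ∈ lengths b := by simpa using hb 0 (Nat.zero_le N)
  have hly := add_mem_lengths hl0 hy
  -- Both `x` and `l + y` are congruent to `m`, so `x` exceeds `l + y` by some `d * j ≤ N`, which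
  -- the progression of `b` supplies.
  have hdvd2 : d ∣ x - (l + y) := by
    rcases le_total m (l + y) with h | h
    · have := Nat.dvd_sub hdvd (dvd_sub_of_mem_lengths hd hm hly h)
      rwa [Nat.sub_sub_sub_cancel_right h] at this
    · have := dvd_add hdvd (dvd_sub_of_mem_lengths hd hly hm h)
      rwa [Nat.sub_add_sub_cancel (by omega) h] at this
  obtain ⟨j, hj⟩ := hdvd2
  have hjN : j ≤ N := (Nat.le_mul_of_pos_left j hd0).trans (by omega)
  have := add_mem_lengths (hb j hjN) hy
  convert this using 1
  omega

/-! ### Unions of sets of lengths -/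

theorem mem_unionLengths (hne : (nonunits H).Nonempty) {k l : ℕ} :
    l ∈ unionLengths H k ↔ ∃ a : H, k ∈ lengths a ∧ l ∈ lengths a := by
  obtain ⟨a, ha⟩ := hne
  have : ¬ ∀ a : H, IsUnit a := fun h => ha (h a)
  rw [unionLengths, if_neg this, Set.mem_ofPred_eq]

theorem modEq_of_mem_lengths {d : ℕ} (hd : IsLeast (distanceSet H) d) {a : H} {k l : ℕ}
    (hk : k ∈ lengths a) (hl : l ∈ lengths a) : k ≡ l [MOD d] := by
  rcases le_total k l with h | h
  · exact (Nat.modEq_iff_dvd' h).2 (dvd_sub_of_mem_lengths hd hk hl h)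
  · exact ((Nat.modEq_iff_dvd' h).2 (dvd_sub_of_mem_lengths hd hl hk h)).symm

theorem mem_progression_iff {m d x : ℕ} : x ∈ progression m d ↔ m ≤ x ∧ m ≡ x [MOD d] := by
  constructor
  · rintro ⟨j, rfl⟩
    exact ⟨by omega, by simp [Nat.ModEq]⟩
  · rintro ⟨h, hmod⟩
    obtain ⟨j, hj⟩ := (Nat.modEq_iff_dvd' h).1 hmod
    exact ⟨j, by omega⟩

/-- Two large congruent numbers close to each other are lengths of a common element. -/
theorem IsStronglyPrimary.exists_common_lengths (hsp : IsStronglyPrimary H) {d : ℕ}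
    (hd : d ∈ distanceSet H) (M : ℕ) :
    ∃ l : ℕ, ∀ x y : ℕ, l ≤ x → x ≤ y → y ≤ x + M → x ≡ y [MOD d] →
      ∃ a : H, x ∈ lengths a ∧ y ∈ lengths a := by
  obtain ⟨hd0, -⟩ := exists_lengths_of_mem_distanceSet hd
  obtain ⟨b, l, hb⟩ := exists_arithmetic_progression hd M
  obtain ⟨u, hu⟩ := hsp.exists_irreducible
  -- The power of the atom `u` shifts the progression of `b` so that it starts at `x`.
  refine ⟨l, fun x y hlx hxy hyM hmod => ⟨b * u ^ (x - l), ?_, ?_⟩⟩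
  · convert add_mem_lengths (hb 0 (Nat.zero_le M)) (mul_mem_lengths_pow (one_mem_lengths hu) (x - l))
      using 1
    omega
  · obtain ⟨j, hj⟩ := (Nat.modEq_iff_dvd' hxy).1 hmod
    have hjM : j ≤ M := (Nat.le_mul_of_pos_left j hd0).trans (by omega)
    convert add_mem_lengths (hb j hjM) (mul_mem_lengths_pow (one_mem_lengths hu) (x - l)) using 1
    omega

/-- The structure theorem for unions of sets of lengths. -/
theorem IsStronglyPrimary.exists_unionLengths_structure (hsp : IsStronglyPrimary H)
    (hlt : IsLocallyTame H) {d : ℕ} (hd : IsLeast (distanceSet H) d) :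
    ∃ M' : ℕ, ∀ (k m x : ℕ), m ∈ unionLengths H k → m + M' ≤ x → (x : ℕ∞) + M' ≤ rhoK H k →
      m ≡ x [MOD d] → x ∈ unionLengths H k := by
  obtain ⟨M, hM⟩ := hsp.exists_lengths_structure hlt hd
  obtain ⟨l, hl⟩ := hsp.exists_common_lengths hd.1 M
  -- The `1` makes `x + M` strictly smaller than the supremum, hence smaller than some member of the
  -- union; `M + l` keeps both `x` and `k` at least `l` when they are close.
  refine ⟨M + l + 1, fun k m x hm hmx hx hmod => ?_⟩
  obtain ⟨a, hka, hma⟩ := (mem_unionLengths hsp.1).1 hm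
  have hkx : k ≡ x [MOD d] := (modEq_of_mem_lengths hd hka hma).trans hmod
  rw [mem_unionLengths hsp.1]
  -- Here `x` is interior between `k` and a large length; in the next case between `m` and `k`;
  -- otherwise `x` and `k` differ by less than `M`.
  by_cases h1 : k + M ≤ x
  · have hlt' : ((x + M : ℕ) : ℕ∞) < rhoK H k := by
      refine lt_of_lt_of_le ?_ hx
      exact_mod_cast (by omega : x + M < x + (M + l + 1))
    obtain ⟨n, hn⟩ := lt_iSup_iff.1 hlt'
    obtain ⟨hnU, hn⟩ := lt_iSup_iff.1 hn
    obtain ⟨b, hkb, hnb⟩ := (mem_unionLengths hsp.1).1 hnU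
    have hxn : x + M < n := by exact_mod_cast hn
    exact ⟨b, hkb, hM b k n x hkb hnb h1 hxn.le ((Nat.modEq_iff_dvd' (by omega)).1 hkx)⟩
  by_cases h2 : x + M ≤ k
  · exact ⟨a, hka, hM a m k x hma hka (by omega) h2 ((Nat.modEq_iff_dvd' (by omega)).1 hmod)⟩
  rcases le_total x k with h | h
  · obtain ⟨b, hxb, hkb⟩ := hl x k (by omega) h (by omega) hkx.symm
    exact ⟨b, hkb, hxb⟩
  · exact hl k x (by omega) h (by omega) hkx

end FactMonoid

theorem mainTheorem2 {H : Type*} [CancelCommMonoid H]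
    (hsp : FactMonoid.IsStronglyPrimary H) (hlt : FactMonoid.IsLocallyTame H) :
    FactMonoid.catenaryDegree H ≤
        min (1 + FactMonoid.Lam H)
          (⨅ (u : H) (_ : Irreducible u),
            max (FactMonoid.primaryExponent u - 1)
              (FactMonoid.localTameDegree (Associates.mk u))) ∧
      (FactMonoid.distanceSet H).Finite ∧
      ∀ d : ℕ, IsLeast (FactMonoid.distanceSet H) d →
        (∃ M : ℕ, ∀ a : H, ∃ m n : ℕ,
          IsLeast (FactMonoid.lengths a) m ∧ IsGreatest (FactMonoid.lengths a) n ∧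
          FactMonoid.progression m d ∩ {x : ℕ | m + M ≤ x ∧ x + M ≤ n} ⊆
            FactMonoid.lengths a ∧
          FactMonoid.lengths a ⊆ FactMonoid.progression m d) ∧
        (∃ M' : ℕ, ∀ k : ℕ, 1 ≤ k → ∃ m : ℕ,
          IsLeast (FactMonoid.unionLengths H k) m ∧
          FactMonoid.progression m d ∩
              {x : ℕ | m + M' ≤ x ∧ (x : ℕ∞) + (M' : ℕ∞) ≤ FactMonoid.rhoK H k} ⊆
            FactMonoid.unionLengths H k ∧
          FactMonoid.unionLengths H k ⊆ FactMonoid.progression m d) := by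
  refine ⟨le_min FactMonoid.catenaryDegree_le_one_add_Lam (le_iInf₂ fun u hu =>
    FactMonoid.catenaryDegree_le fun a z hz z' hz' => hsp.isChained hu a hz hz'),
    hsp.distanceSet_finite hlt, fun d hd => ⟨?_, ?_⟩⟩
  · obtain ⟨M, hM⟩ := hsp.exists_lengths_structure hlt hd
    refine ⟨M, fun a => ?_⟩
    obtain ⟨m, n, hm, hn⟩ := hsp.exists_isLeast_isGreatest a
    refine ⟨m, n, hm, hn, fun x hx => ?_, fun x hx => ?_⟩
    · obtain ⟨h1, h2⟩ := FactMonoid.mem_progression_iff.1 hx.1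
      exact hM a m n x hm.1 hn.1 hx.2.1 hx.2.2 ((Nat.modEq_iff_dvd' h1).1 h2)
    · exact FactMonoid.mem_progression_iff.2
        ⟨hm.2 hx, FactMonoid.modEq_of_mem_lengths hd hm.1 hx⟩
  · obtain ⟨M', hM'⟩ := hsp.exists_unionLengths_structure hlt hd
    refine ⟨M', fun k _ => ?_⟩
    obtain ⟨u, hu⟩ := hsp.exists_irreducible
    have hk : k ∈ FactMonoid.lengths (u ^ k) := by
      simpa using FactMonoid.mul_mem_lengths_pow (FactMonoid.one_mem_lengths hu) k
    have hne : (FactMonoid.unionLengths H k).Nonempty :=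
      ⟨k, (FactMonoid.mem_unionLengths hsp.1).2 ⟨_, hk, hk⟩⟩
    have hmem := Nat.sInf_mem hne
    have hmod : ∀ x ∈ FactMonoid.unionLengths H k, k ≡ x [MOD d] := fun x hx => by
      obtain ⟨a, hka, hxa⟩ := (FactMonoid.mem_unionLengths hsp.1).1 hx
      exact FactMonoid.modEq_of_mem_lengths hd hka hxa
    refine ⟨_, ⟨hmem, fun x hx => Nat.sInf_le hx⟩, fun x hx => ?_, fun x hx => ?_⟩
    · exact hM' k _ x hmem hx.2.1 hx.2.2 (FactMonoid.mem_progression_iff.1 hx.1).2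
    · exact FactMonoid.mem_progression_iff.2
        ⟨Nat.sInf_le hx, (hmod _ hmem).symm.trans (hmod x hx)⟩
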